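/- Let $F=\mathbb F_q$ be a finite field with $q$ elements and let $1\le \ell\le m$ be integers. Let $G(\ell,m)$ be the set of $\ell$-dimensional subspaces of $F^m$. For every $P\in G(\ell,m)$ fix an $\ell\times m$ matrix $M_P$ over $F$ whose rows form a basis of $P$. The Grassmann code $C(\ell,m)\subseteq F^{G(\ell,m)}$ is the set of all words $\bigl(\sum_\alpha f_\alpha\, p_\alpha(M_P)\bigr)_{P\in G(\ell,m)}$, where $\alpha$ runs through the sequences $1\le\alpha_1<\dots<\alpha_\ell\le m$, $p_\alpha(M_P)$ is the $\ell\times\ell$ minor of $M_P$ on the columns $\alpha$, and the coefficients $f_\alpha\in F$ are arbitrary. A parity check of $C(\ell,m)$ is a word $\omega\in F^{G(\ell,m)}$ with $\sum_Q c_Q\omega_Q=0$ for all $c\in C(\ell,m)$. A finite set $\mathcal J$ of parity checks is orthogonal on the coordinate $P$ if $\omega_P=1$ for all $\omega\in\mathcal J$, and for every $Q\ne P$ at most one $\omega\in\mathcal J$ has $\omega_Q\ne0$. Put $$J:=\sum_{i=1}^{\ell}\left\lfloor \frac q2\right\rfloor^i q^{i^2-i}{\ell\brack i}_q{m-\ell\brack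 i}_q,\qquad {n\brack k}_q:=\frac{(q^n-1)(q^{n-1}-1)\cdots(q^{n-k+1}-1)}{(q^k-1)(q^{k-1}-1)\cdots(q-1)}$$ (so that ${n\brack k}_q=0$ for $k>n$). (1) For every $P\in G(\ell,m)$ there is a set of exactly $J$ parity checks of $C(\ell,m)$ that is orthogonal on the coordinate $P$. (2) Consequently, one-step majority logic decoding corrects up to $\lfloor J/2\rfloor$ errors: whenever $\mathcal J_P$, for each $P\in G(\ell,m)$, is a set of $J$ parity checks of $C(\ell,m)$ orthogonal on $P$, and $w=c+e$ with $c\in C(\ell,m)$ and $e\in F^{G(\ell,m)}$ of Hamming weight at most $\lfloor J/2\rfloor$, then $\widehat c=c$. Here the decoded word $\widehat c$ is computed from $w$ coordinate by coordinate: if, for some $\alpha\in F$, more than half of the $J$ values $\bigl(\sum_{Q}w_Q\omega_Q\bigr)-w_P$ ($\omega\in\mathcal J_P$) are equal to $-\alpha$, then $\widehat c_P:=\alpha$; otherwise $\widehat c_P:=w_P$. -/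

import Mathlib

open scoped Classical in
/-- The `q`-ary majority vote on one coordinate: if a strict majority of the values
`S_ω(w) - w_i` (`ω ∈ 𝒥`), where `S_ω(w) = ∑ a, w_a ω_a`, equals `-α`, the output is this `α`;
otherwise it is `w_i`. -/
noncomputable def majorityVote {ι F : Type*} [Fintype ι] [Field F]
    (𝒥 : Finset (ι → F)) (i : ι) (w : ι → F) : F :=
  if h : ∃ α : F, 𝒥.card < 2 * (𝒥.filter fun ω => (∑ a, w a * ω a) - w i = -α).card
  then h.choose else w i

/-- The value that has the strict majority is unique, so `majorityVote` involves no choice. -/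
theorem majorityVote_eq {ι F : Type*} [Fintype ι] [Field F] [DecidableEq F]
    (𝒥 : Finset (ι → F)) (i : ι) (w : ι → F) (α : F)
    (h : 𝒥.card < 2 * (𝒥.filter fun ω => (∑ a, w a * ω a) - w i = -α).card) :
    majorityVote 𝒥 i w = α := by
  classical
  have h' : ∃ α : F, 𝒥.card < 2 * (𝒥.filter fun ω => (∑ a, w a * ω a) - w i = -α).card :=
    ⟨α, by convert h⟩
  have e : majorityVote 𝒥 i w = h'.choose := by
    unfold majorityVote
    rw [dif_pos (by convert h')]
    congr!
  have hs := h'.choose_spec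
  rw [e]
  by_contra hne
  have hd : Disjoint (𝒥.filter fun ω => (∑ a, w a * ω a) - w i = -h'.choose)
      (𝒥.filter fun ω => (∑ a, w a * ω a) - w i = -α) := by
    rw [Finset.disjoint_filter]
    intro ω _ h1 h2
    exact hne (neg_injective (h1.symm.trans h2))
  have hc := Finset.card_le_card (Finset.union_subset
    (Finset.filter_subset (fun ω => (∑ a, w a * ω a) - w i = -h'.choose) 𝒥)
    (Finset.filter_subset (fun ω => (∑ a, w a * ω a) - w i = -α) 𝒥))
  rw [Finset.card_union_of_disjoint hd] at hc
  have h2 : 𝒥.card < 2 * (𝒥.filter fun ω => (∑ a, w a * ω a) - w i = -α).card := by convert h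
  omega

/-- One-step majority logic decoding with the set `𝒥 i` of parity checks for each coordinate
`i`: all coordinates are voted on separately, from the received word `w`. -/
noncomputable def majorityDecode {ι F : Type*} [Fintype ι] [Field F]
    (𝒥 : ι → Finset (ι → F)) (w : ι → F) : ι → F :=
  fun i => majorityVote (𝒥 i) i w

/-- The dual code; its elements are the parity checks of `C`. -/
def dualCode {ι F : Type*} [Fintype ι] [Field F] (C : Submodule F (ι → F)) :
    Submodule F (ι → F) where
  carrier := {ω | ∀ c ∈ C, ∑ a, c a * ω a = 0}
  zero_mem' := by intro c _; simp
  add_mem' := by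
    intro x y hx hy c hc
    simp [mul_add, Finset.sum_add_distrib, hx c hc, hy c hc]
  smul_mem' := by
    intro r x hx c hc
    have : ∑ a, c a * (r • x) a = r * ∑ a, c a * x a := by
      rw [Finset.mul_sum]
      exact Finset.sum_congr rfl fun a _ => by simp; ring
    rw [this, hx c hc, mul_zero]

open scoped Classical in
/-- The words in `𝒥` are parity checks of `C` and they are orthogonal on the coordinate `i`: in
the matrix that has the elements of `𝒥` as its rows, every entry of column `i` is `1`, and every
other column has at most one non-zero entry. -/
def OrthogonalParityChecks {ι F : Type*} [Fintype ι] [Field F] (C : Submodule F (ι → F))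
    (𝒥 : Finset (ι → F)) (i : ι) : Prop :=
  (∀ ω ∈ 𝒥, ω ∈ dualCode C) ∧ (∀ ω ∈ 𝒥, ω i = 1) ∧
    ∀ j, j ≠ i → (𝒥.filter fun ω => ω j ≠ 0).card ≤ 1

/-- The Gaussian binomial coefficient
`(q^n - 1)(q^(n-1) - 1) ⋯ (q^(n-k+1) - 1) / ((q^k - 1) ⋯ (q - 1))`; it is `0` for `k > n`, and the
division is exact (see `gaussBinom_mul`). -/
def gaussBinom (q n k : ℕ) : ℕ :=
  (∏ j ∈ Finset.range k, (q ^ (n - j) - 1)) / ∏ j ∈ Finset.range k, (q ^ (j + 1) - 1)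

theorem gaussBinom_mul (q n k : ℕ) (hq : 2 ≤ q) :
    gaussBinom q n k * ∏ j ∈ Finset.range k, (q ^ (j + 1) - 1) =
      ∏ j ∈ Finset.range k, (q ^ (n - j) - 1) := by
  refine Nat.div_mul_cancel ?_
  induction n generalizing k with
  | zero =>
    cases k with
    | zero => simp
    | succ k => simp [Finset.prod_range_succ']
  | succ n ih =>
    cases k with
    | zero => simp
    | succ k =>
      have e : ∏ j ∈ Finset.range (k + 1), (q ^ (n + 1 - j) - 1) =
          (∏ j ∈ Finset.range k, (q ^ (n - j) - 1)) * (q ^ (n + 1) - 1) := by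
        rw [Finset.prod_range_succ']
        simp
      rw [e]
      by_cases hk : k ≤ n
      · have e2 : q ^ (n + 1) - 1 = (q ^ (k + 1) - 1) * q ^ (n - k) + (q ^ (n - k) - 1) := by
          have h1 : 1 ≤ q ^ (k + 1) := Nat.one_le_pow _ _ (by omega)
          have h2 : 1 ≤ q ^ (n - k) := Nat.one_le_pow _ _ (by omega)
          have h3 : q ^ (n + 1) = q ^ (k + 1) * q ^ (n - k) := by
            rw [← pow_add]; congr 1; omega
          have h4 : 1 * q ^ (n - k) ≤ q ^ (k + 1) * q ^ (n - k) := Nat.mul_le_mul_right _ h1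
          rw [Nat.sub_mul, h3]
          omega
        rw [e2, mul_add]
        refine dvd_add ?_ ?_
        · rw [Finset.prod_range_succ, ← mul_assoc]
          exact dvd_mul_of_dvd_left (mul_dvd_mul_right (ih k) _) _
        · have := ih (k + 1)
          rwa [Finset.prod_range_succ (fun j => q ^ (n - j) - 1)] at this
      · have : ∏ j ∈ Finset.range k, (q ^ (n - j) - 1) = 0 :=
          Finset.prod_eq_zero (Finset.mem_range.2 (by omega : n < k)) (by simp)
        simp [this]

/-- The number `∑_{i=1}^ℓ ⌊q/2⌋^i q^(i²-i) [ℓ i]_q [m-ℓ i]_q`. -/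
def numChecks (q ℓ m : ℕ) : ℕ :=
  ∑ i ∈ Finset.Icc 1 ℓ,
    (q / 2) ^ i * q ^ (i ^ 2 - i) * gaussBinom q ℓ i * gaussBinom q (m - ℓ) i

/-- The points of the Grassmannian: the `ℓ`-dimensional subspaces of `F^m`. -/
abbrev GrassmannPoint (F : Type*) [Field F] (ℓ m : ℕ) : Type _ :=
  {P : Submodule F (Fin m → F) // Module.finrank F P = ℓ}

noncomputable instance GrassmannPoint.instFintype (F : Type*) [Field F] [Finite F] (ℓ m : ℕ) :
    Fintype (GrassmannPoint F ℓ m) :=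
  Fintype.ofFinite _

/-- `M` is a choice of representatives for the points of the Grassmannian: the rows of the
`ℓ × m` matrix `M P` form a basis of `P`. -/
def IsRepresentativeChoice {F : Type*} [Field F] {ℓ m : ℕ}
    (M : GrassmannPoint F ℓ m → Matrix (Fin ℓ) (Fin m) F) : Prop :=
  ∀ P, LinearIndependent F (M P).row ∧ Submodule.span F (Set.range (M P).row) = P.1

/-- The value at `P` of the linear form `∑_α f_α X_α` in the `ℓ × ℓ` minors `X_α`, where
`α` runs through the increasing sequences `α_1 < ⋯ < α_ℓ` of column indices, and `P` is
represented by `M P`. -/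
noncomputable def plueckerEval {F : Type*} [Field F] {ℓ m : ℕ}
    (M : GrassmannPoint F ℓ m → Matrix (Fin ℓ) (Fin m) F) :
    ((Fin ℓ ↪o Fin m) → F) →ₗ[F] (GrassmannPoint F ℓ m → F) where
  toFun f := fun P => ∑ α, f α * ((M P).submatrix id α).det
  map_add' f g := by
    funext P
    simp [add_mul, Finset.sum_add_distrib]
  map_smul' r f := by
    funext P
    simp [Finset.mul_sum, mul_assoc]

/-- The Grassmann code `C(ℓ, m)`, with coordinates indexed by the points of the Grassmannian, for
the representatives `M`: the image of the evaluation map. -/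
noncomputable def grassmannCode {F : Type*} [Field F] {ℓ m : ℕ}
    (M : GrassmannPoint F ℓ m → Matrix (Fin ℓ) (Fin m) F) :
    Submodule F (GrassmannPoint F ℓ m → F) :=
  LinearMap.range (plueckerEval M)

/-!
Every coordinate `c P` of a code word can be recovered from many disjoint sets of other
coordinates.

Let `U ≤ P ≤ W` be a flag with `dim (P / U) = dim (W / P) = i`. With `u` a basis of `U`, vectors
`y` completing it to a basis of `P`, and `x` lifting a basis of `W / P`, each `i × i` matrix `B`
gives the point `Q B` spanned by `u` and the rows `x j + ∑ k, B j k • y k`. From `Q B` one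
recovers `U = Q B ⊓ P`, the subspace `W / P` as the image of `Q B`, and the matrix `B`. A code
word is the restriction of a form that is multilinear in the rows of a basis. If the `j`-th
diagonal entry of `B` is `a j` or `b j`, the difference of the two rows is `(a j - b j) • y j`, so
expanding `ψ (u, ((a j - b j) • y j)_j)` expresses `c P` through the coordinates at the `2 ^ i`
points `Q (A + diagonal)` with diagonal entries in the sets `{a j, b j}`
(`MultilinearMap.prod_sub_mul_eq_sum_graphBasis`, `exists_graphPoints`). The coefficients include
the determinants of the changes of basis to the chosen representatives, which are units
(`exists_minorForm_eq_mul`).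

Taking matrices `A` with zero diagonal (`q ^ (i ^ 2 - i)` of them) and the pairs `{a j, b j}` from
`⌊q / 2⌋` disjoint pairs in the field, these sets of points are disjoint. The flags of type `i`
are pairs of a subspace of codimension `i` in `P` and one of dimension `i` in the quotient by `P`,
so they are counted by Gaussian binomials (`natCard_submodule_finrank_add_eq`,
`natCard_submodule_finrank_eq`).

For the decoder, an error off `P` spoils at most one of the checks orthogonal on `P`. If `P`
itself is correct, at most half of the checks are spoiled, and a tie keeps the received symbol; if
`P` is in error, fewer than half are spoiled (`OrthogonalParityChecks.majorityVote_add`).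
-/

/-! ### Majority voting with orthogonal parity checks -/

open scoped Classical in
/-- Among orthogonal checks on `i`, at most one per erroneous coordinate other than `i` fails to
report the sent symbol `c i`. -/
theorem OrthogonalParityChecks.card_wrong_le {ι F : Type*} [Fintype ι] [Field F]
    [DecidableEq F] {C : Submodule F (ι → F)} {𝒥 : Finset (ι → F)} {i : ι}
    (h : OrthogonalParityChecks C 𝒥 i) {c : ι → F} (hc : c ∈ C) (e : ι → F) :
    (𝒥.filter fun ω => ¬ (∑ a, (c + e) a * ω a) - (c + e) i = -c i).card ≤
      ((Finset.univ.erase i).filter fun a => e a ≠ 0).card := by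
  obtain ⟨hd, h1, ho⟩ := h
  refine Finset.card_le_card_of_forall_subsingleton (fun ω a => ω a ≠ 0) ?_ ?_
  · intro ω hω
    rw [Finset.mem_filter] at hω
    by_contra hcon
    push Not at hcon
    refine hω.2 ?_
    have hz : ∑ a ∈ Finset.univ.erase i, e a * ω a = 0 := by
      refine Finset.sum_eq_zero fun a ha => ?_
      by_cases hea : e a = 0
      · simp [hea]
      · simp [hcon a (Finset.mem_filter.2 ⟨ha, hea⟩)]
    have hs : ∑ a, (c + e) a * ω a = e i := by
      simp only [Pi.add_apply, add_mul, Finset.sum_add_distrib]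
      rw [hd ω hω.1 c hc, ← Finset.add_sum_erase _ _ (Finset.mem_univ i), hz, h1 ω hω.1]
      simp
    rw [hs, Pi.add_apply]
    ring
  · intro a ha ω hω ω' hω'
    have hai : a ≠ i := Finset.ne_of_mem_erase (Finset.mem_filter.1 ha).1
    have ho' : (𝒥.filter fun ω => ω a ≠ 0).card ≤ 1 := by convert ho a hai
    refine Finset.card_le_one.1 ho' ω ?_ ω' ?_
    · exact Finset.mem_filter.2 ⟨(Finset.mem_filter.1 hω.1).1, hω.2⟩
    · exact Finset.mem_filter.2 ⟨(Finset.mem_filter.1 hω'.1).1, hω'.2⟩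

theorem OrthogonalParityChecks.majorityVote_add {ι F : Type*} [Fintype ι] [Field F]
    [DecidableEq F] {C : Submodule F (ι → F)} {𝒥 : Finset (ι → F)} {i : ι}
    (h : OrthogonalParityChecks C 𝒥 i) {c : ι → F} (hc : c ∈ C) (e : ι → F)
    (he : 2 * hammingNorm e ≤ 𝒥.card) :
    majorityVote 𝒥 i (c + e) = c i := by
  classical
  have hw := h.card_wrong_le hc e
  have hsplit := Finset.card_filter_add_card_filter_not (s := 𝒥)
    (fun ω => (∑ a, (c + e) a * ω a) - (c + e) i = -c i)
  have hn : ((Finset.univ.erase i).filter fun a => e a ≠ 0) =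
      (Finset.univ.filter fun a => e a ≠ 0).erase i := by
    ext a; simp
  have hnorm : hammingNorm e = (Finset.univ.filter fun a => e a ≠ 0).card := by
    unfold hammingNorm
    congr!
  rw [hn] at hw
  by_cases hmaj :
      𝒥.card < 2 * (𝒥.filter fun ω => (∑ a, (c + e) a * ω a) - (c + e) i = -c i).card
  · exact majorityVote_eq 𝒥 i (c + e) (c i) (by convert hmaj)
  -- Without a strict majority for `c i` exactly half of the checks are wrong, so that all the
  -- errors lie off `i`; nothing else can have a strict majority then, and the vote keeps `w i`.
  have hei : e i = 0 := by
    by_contra hne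
    have hmem : i ∈ Finset.univ.filter fun a => e a ≠ 0 := by simpa using hne
    have := Finset.card_erase_add_one hmem
    omega
  have hno : ¬ ∃ α : F,
      𝒥.card < 2 * (𝒥.filter fun ω => (∑ a, (c + e) a * ω a) - (c + e) i = -α).card := by
    rintro ⟨α, hα⟩
    by_cases hαc : α = c i
    · exact hmaj (hαc ▸ hα)
    have hsub : (𝒥.filter fun ω => (∑ a, (c + e) a * ω a) - (c + e) i = -α) ⊆
        𝒥.filter fun ω => ¬ (∑ a, (c + e) a * ω a) - (c + e) i = -c i := by
      intro ω hω
      rw [Finset.mem_filter] at hω ⊢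
      exact ⟨hω.1, fun h' => hαc (neg_injective (hω.2.symm.trans h'))⟩
    have h1 := Finset.card_le_card hsub
    have h2 := Finset.card_erase_le (s := Finset.univ.filter fun a => e a ≠ 0) (a := i)
    omega
  unfold majorityVote
  rw [dif_neg (by convert hno)]
  simp [hei]

/-- A family of words whose supports meet only in `i`, each containing another coordinate, is
injectively indexed, so it yields as many orthogonal parity checks as it has indices. -/
theorem exists_orthogonalParityChecks_of_family {ι F K : Type*} [Fintype ι] [Field F] [Fintype K]
    (C : Submodule F (ι → F)) (i : ι) (ω : K → ι → F) (hd : ∀ k, ω k ∈ dualCode C)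
    (h1 : ∀ k, ω k i = 1) (hne : ∀ k, ∃ j, j ≠ i ∧ ω k j ≠ 0)
    (hdisj : ∀ k k' j, j ≠ i → ω k j ≠ 0 → ω k' j ≠ 0 → k = k') :
    ∃ 𝒥 : Finset (ι → F), OrthogonalParityChecks C 𝒥 i ∧ 𝒥.card = Fintype.card K := by
  classical
  have hinj : Function.Injective ω := by
    intro k k' hk
    obtain ⟨j, hj, hkj⟩ := hne k
    exact hdisj k k' j hj hkj (hk ▸ hkj)
  refine ⟨Finset.univ.image ω, ⟨?_, ?_, ?_⟩, ?_⟩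
  · simpa using hd
  · simpa using h1
  · intro j hj
    refine Finset.card_le_one.2 ?_
    simp only [Finset.mem_filter, Finset.mem_image, Finset.mem_univ, true_and]
    rintro _ ⟨⟨k, rfl⟩, hk⟩ _ ⟨⟨k', rfl⟩, hk'⟩
    rw [hdisj k k' j hj hk hk']
  · rw [Finset.card_image_of_injective _ hinj, Finset.card_univ]

/-- A relation `c i = ∑ s, μ s * c (Q s)` between the coordinates of all code words, with distinct
`Q s ≠ i`, is a parity check with entry `1` at `i`. -/
theorem exists_mem_dualCode_of_relation {ι F T : Type*} [Fintype ι] [Field F] [Fintype T]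
    [Nonempty T] (C : Submodule F (ι → F)) (i : ι) (Q : T → ι) (hQ : Function.Injective Q)
    (hQi : ∀ s, Q s ≠ i) (μ : T → F) (hμ : ∀ s, μ s ≠ 0)
    (h : ∀ c ∈ C, c i = ∑ s, μ s * c (Q s)) :
    ∃ ω ∈ dualCode C, ω i = 1 ∧ (∃ j, j ≠ i ∧ ω j ≠ 0) ∧
      ∀ j, j ≠ i → ω j ≠ 0 → ∃ s, j = Q s := by
  classical
  refine ⟨Pi.single i 1 - ∑ s, Pi.single (Q s) (μ s), ?_, ?_, ?_, ?_⟩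
  · intro c hc
    simp only [Pi.sub_apply, Finset.sum_apply, mul_sub, Finset.mul_sum, Finset.sum_sub_distrib]
    rw [Finset.sum_comm]
    simp [Pi.single_apply, h c hc, mul_comm]
  · simp [fun s => (hQi s).symm]
  · obtain ⟨s⟩ := ‹Nonempty T›
    refine ⟨Q s, hQi s, ?_⟩
    simp [Pi.single_apply, hQi s, hQ.eq_iff, hμ s]
  · intro j hj hne
    by_contra hcon
    push Not at hcon
    exact hne (by simp [hj, hcon])

/-! ### Counting subspaces -/

theorem prod_pow_sub_pow (q n k : ℕ) :
    ∏ j ∈ Finset.range k, (q ^ n - q ^ j) =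
      (∏ j ∈ Finset.range k, q ^ j) * ∏ j ∈ Finset.range k, (q ^ (n - j) - 1) := by
  rw [← Finset.prod_mul_distrib]
  by_cases hk : k ≤ n
  · refine Finset.prod_congr rfl fun j hj => ?_
    rw [Finset.mem_range] at hj
    rw [Nat.mul_sub, ← pow_add, mul_one]
    congr 2
    omega
  · have hn : n ∈ Finset.range k := Finset.mem_range.2 (by omega)
    rw [Finset.prod_eq_zero hn (by simp), Finset.prod_eq_zero hn (by simp)]

/-- The Gaussian binomial as a quotient of numbers of independent families. -/
theorem gaussBinom_mul_prod (q n k : ℕ) (hq : 2 ≤ q) :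
    gaussBinom q n k * ∏ j ∈ Finset.range k, (q ^ k - q ^ j) =
      ∏ j ∈ Finset.range k, (q ^ n - q ^ j) := by
  rw [prod_pow_sub_pow, prod_pow_sub_pow, ← gaussBinom_mul q n k hq,
    ← Finset.prod_range_reflect (fun j => q ^ (j + 1) - 1)]
  have : ∏ j ∈ Finset.range k, (q ^ (k - j) - 1) =
      ∏ j ∈ Finset.range k, (q ^ (k - 1 - j + 1) - 1) := by
    refine Finset.prod_congr rfl fun j hj => ?_
    rw [Finset.mem_range] at hj
    congr 2
    omega
  rw [this]
  ring

/-- An independent family of `k` vectors amounts to a basis of a `k`-dimensional subspace. -/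
theorem bijective_linearIndependent_of_sigma (F V : Type*) [Field F] [AddCommGroup V] [Module F V]
    [FiniteDimensional F V] (k : ℕ) :
    Function.Bijective (fun t : Σ W : {W : Submodule F V // Module.finrank F W = k},
        {s : Fin k → W.1 // LinearIndependent F s} =>
      (⟨fun j => (t.2.1 j : V), t.2.2.map' _ (Submodule.ker_subtype _)⟩ :
        {s : Fin k → V // LinearIndependent F s})) := by
  constructor
  · have hspan : ∀ (W : Submodule F V) (_ : Module.finrank F W = k) (s : Fin k → W)
        (_ : LinearIndependent F s), Submodule.span F (Set.range fun j => (s j : V)) = W := by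
      intro W hW s hs
      have hli : LinearIndependent F fun j => (s j : V) := hs.map' _ (Submodule.ker_subtype _)
      refine Submodule.eq_of_le_of_finrank_eq ?_ ?_
      · rw [Submodule.span_le]
        rintro _ ⟨j, rfl⟩
        exact (s j).2
      · rw [finrank_span_eq_card hli, hW, Fintype.card_fin]
    rintro ⟨⟨W, hW⟩, s, hs⟩ ⟨⟨W', hW'⟩, s', hs'⟩ h
    have h' : (fun j => (s j : V)) = fun j => (s' j : V) := congrArg Subtype.val h
    have hWW : W = W' := by rw [← hspan W hW s hs, h', hspan W' hW' s' hs']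
    subst hWW
    have hss : s = s' := funext fun j => Subtype.ext (congrFun h' j)
    subst hss
    rfl
  · intro s
    exact ⟨⟨⟨Submodule.span F (Set.range s.1), by simpa using finrank_span_eq_card s.2⟩,
      ⟨fun j => ⟨s.1 j, Submodule.subset_span ⟨j, rfl⟩⟩, linearIndependent_span s.2⟩⟩, rfl⟩

theorem natCard_submodule_finrank_eq (F V : Type*) [Field F] [Fintype F] [AddCommGroup V]
    [Module F V] [FiniteDimensional F V] (k : ℕ) :
    Nat.card {W : Submodule F V // Module.finrank F W = k} =
      gaussBinom (Fintype.card F) (Module.finrank F V) k := by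
  classical
  have hq : 2 ≤ Fintype.card F := Fintype.one_lt_card
  have : Finite V := Module.finite_of_finite F
  have : Fintype {W : Submodule F V // Module.finrank F W = k} := Fintype.ofFinite _
  by_cases hk : k ≤ Module.finrank F V
  · have h := (Nat.card_congr (Equiv.ofBijective _
      (bijective_linearIndependent_of_sigma F V k))).symm
    rw [card_linearIndependent hk, Nat.card_sigma] at h
    have h2 : ∀ W : {W : Submodule F V // Module.finrank F W = k},
        Nat.card {s : Fin k → W.1 // LinearIndependent F s} =
          ∏ j ∈ Finset.range k, (Fintype.card F ^ k - Fintype.card F ^ j) := by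
      intro W
      rw [card_linearIndependent W.2.ge, W.2,
        Finset.prod_range fun j => Fintype.card F ^ k - Fintype.card F ^ j]
    rw [Finset.sum_congr rfl fun W _ => h2 W, Finset.sum_const, smul_eq_mul, Finset.card_univ,
      ← Finset.prod_range fun j => Fintype.card F ^ Module.finrank F V - Fintype.card F ^ j,
      ← gaussBinom_mul_prod _ _ k hq] at h
    rw [Nat.card_eq_fintype_card]
    refine (Nat.eq_of_mul_eq_mul_right ?_ h).symm
    refine Finset.prod_pos fun j hj => ?_
    exact Nat.sub_pos_of_lt (Nat.pow_lt_pow_right hq (Finset.mem_range.1 hj))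
  · have : IsEmpty {W : Submodule F V // Module.finrank F W = k} :=
      ⟨fun W => hk (W.2 ▸ Submodule.finrank_le W.1)⟩
    rw [Nat.card_of_isEmpty, gaussBinom, Finset.prod_eq_zero
      (Finset.mem_range.2 (by omega : Module.finrank F V < k)) (by simp), Nat.zero_div]

/-- Subspaces of codimension `k` are counted through their annihilators in the dual space. -/
theorem natCard_submodule_finrank_add_eq (F V : Type*) [Field F] [Fintype F] [AddCommGroup V]
    [Module F V] [FiniteDimensional F V] (k : ℕ) :
    Nat.card {W : Submodule F V // Module.finrank F W + k = Module.finrank F V} =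
      gaussBinom (Fintype.card F) (Module.finrank F V) k := by
  have hdual := natCard_submodule_finrank_eq F (Module.Dual F V) k
  rw [Subspace.dual_finrank_eq] at hdual
  rw [← hdual]
  refine Nat.card_congr ((Subspace.orderIsoFiniteDimensional (K := F) (V := V)).toEquiv.trans
    OrderDual.ofDual |>.subtypeEquiv fun W => ?_)
  have h := Subspace.finrank_add_finrank_dualAnnihilator_eq W
  change _ ↔ Module.finrank F W.dualAnnihilator = k
  omega

/-! ### Graph spaces over a flag -/

theorem exists_basis_of_map {F V W : Type*} [Field F] [AddCommGroup V] [Module F V]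
    [AddCommGroup W] [Module F W] [FiniteDimensional F V] (f : V →ₗ[F] W) (P : Submodule F V)
    {i : ℕ} (hi : Module.finrank F (P.map f) = i) :
    ∃ y : Fin i → V, (∀ j, y j ∈ P) ∧ LinearIndependent F (f ∘ y) ∧
      Submodule.span F (Set.range (f ∘ y)) = P.map f := by
  let b := Module.finBasisOfFinrankEq F (P.map f) hi
  have hb : ∀ j, ∃ y ∈ P, f y = b j := fun j => (Submodule.mem_map.1 (b j).2)
  choose y hyP hy using hb
  have hfy : f ∘ y = (P.map f).subtype ∘ b := funext hy
  refine ⟨y, hyP, ?_, ?_⟩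
  · rw [hfy]
    exact b.linearIndependent.map' _ (Submodule.ker_subtype _)
  · rw [hfy, Set.range_comp, Submodule.span_image, b.span_eq, Submodule.map_top,
      Submodule.range_subtype]

theorem finrank_map_mkQ_add {F V : Type*} [Field F] [AddCommGroup V] [Module F V]
    [FiniteDimensional F V] {U P : Submodule F V} (hUP : U ≤ P) :
    Module.finrank F (P.map U.mkQ) + Module.finrank F U = Module.finrank F P := by
  have h := LinearMap.finrank_range_add_finrank_ker (U.mkQ ∘ₗ P.subtype)
  rwa [LinearMap.range_comp, Submodule.range_subtype, LinearMap.ker_comp, Submodule.ker_mkQ,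
    (Submodule.comapSubtypeEquivOfLe hUP).finrank_eq] at h

/-- A basis of the space that the matrix `B` describes as a graph: the vectors `u`, followed by
the rows `x j + ∑ k, B j k • y k`. -/
def graphBasis {F V κ ι : Type*} [Field F] [AddCommGroup V] [Module F V] [Fintype ι] (u : κ → V)
    (x y : ι → V) (B : Matrix ι ι F) : κ ⊕ ι → V :=
  Sum.elim u fun j => x j + ∑ k, B j k • y k

section

variable {F V κ ι : Type*} [Field F] [AddCommGroup V] [Module F V] [Fintype ι]
  {P : Submodule F V} {u : κ → V} {x y : ι → V}

theorem mkQ_comp_graphBasis_inr (hyP : ∀ j, y j ∈ P) (B : Matrix ι ι F) :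
    (P.mkQ ∘ fun j => graphBasis u x y B (Sum.inr j)) = P.mkQ ∘ x := by
  funext j
  have : ∑ k, B j k • y k ∈ P := Submodule.sum_mem _ fun k _ => P.smul_mem _ (hyP k)
  simp only [graphBasis, Sum.elim_inr, Function.comp_apply, map_add,
    (Submodule.Quotient.mk_eq_zero P).2 this, Submodule.mkQ_apply, add_zero]

theorem linearIndependent_graphBasis (hu : LinearIndependent F u) (huP : ∀ k, u k ∈ P)
    (hx : LinearIndependent F (P.mkQ ∘ x)) (hyP : ∀ j, y j ∈ P) (B : Matrix ι ι F) :
    LinearIndependent F (graphBasis u x y B) := by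
  have hu' : LinearIndependent F fun k => (⟨u k, huP k⟩ : P) :=
    LinearIndependent.of_comp P.subtype hu
  refine LinearIndependent.sumElim_of_quotient hu' _ ?_
  have := mkQ_comp_graphBasis_inr (u := u) (x := x) hyP B
  rw [← this] at hx
  exact hx

theorem map_mkQ_span_graphBasis (huP : ∀ k, u k ∈ P) (hyP : ∀ j, y j ∈ P) (B : Matrix ι ι F) :
    (Submodule.span F (Set.range (graphBasis u x y B))).map P.mkQ =
      Submodule.span F (Set.range (P.mkQ ∘ x)) := by
  have h := mkQ_comp_graphBasis_inr (u := u) (x := x) hyP B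
  have hr : Set.range (graphBasis u x y B) =
      Set.range u ∪ Set.range fun j => graphBasis u x y B (Sum.inr j) := Set.Sum.elim_range _ _
  have hz : (Submodule.span F (Set.range u)).map P.mkQ = ⊥ := by
    rw [← le_bot_iff, Submodule.map_le_iff_le_comap, Submodule.span_le]
    rintro _ ⟨k, rfl⟩
    simpa using huP k
  rw [hr, Submodule.span_union, Submodule.map_sup, hz, bot_sup_eq, ← h, Submodule.map_span,
    ← Set.range_comp]

theorem span_graphBasis_inf (huP : ∀ k, u k ∈ P) (hyP : ∀ j, y j ∈ P)
    (hx : LinearIndependent F (P.mkQ ∘ x)) (B : Matrix ι ι F) :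
    Submodule.span F (Set.range (graphBasis u x y B)) ⊓ P =
      Submodule.span F (Set.range u) := by
  have hr : Set.range (graphBasis u x y B) =
      Set.range u ∪ Set.range fun j => graphBasis u x y B (Sum.inr j) := Set.Sum.elim_range _ _
  have huP' : Submodule.span F (Set.range u) ≤ P := by
    rw [Submodule.span_le]
    rintro _ ⟨k, rfl⟩
    exact huP k
  refine le_antisymm ?_ (le_inf (Submodule.span_mono (hr ▸ Set.subset_union_left)) huP')
  rintro z ⟨hz, hzP⟩
  rw [hr, Submodule.span_union] at hz
  obtain ⟨a, ha, b, hb, rfl⟩ := Submodule.mem_sup.1 hz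
  obtain ⟨g, rfl⟩ := (Submodule.mem_span_range_iff_exists_fun F).1 hb
  have hbP : ∑ j, g j • graphBasis u x y B (Sum.inr j) ∈ P :=
    (Submodule.add_mem_iff_right P (huP' ha)).1 hzP
  have h0 : ∑ j, g j • (P.mkQ ∘ x) j = 0 := by
    rw [← mkQ_comp_graphBasis_inr (u := u) (x := x) hyP B]
    have := (Submodule.Quotient.mk_eq_zero P).2 hbP
    rw [← Submodule.mkQ_apply, map_sum] at this
    simpa using this
  have hg := Fintype.linearIndependent_iff.1 hx g h0
  simpa [hg] using ha

theorem span_graphBasis_injective (huP : ∀ k, u k ∈ P) (hyP : ∀ j, y j ∈ P)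
    (hx : LinearIndependent F (P.mkQ ∘ x))
    (hy : LinearIndependent F ((Submodule.span F (Set.range u)).mkQ ∘ y)) :
    Function.Injective fun B : Matrix ι ι F =>
      Submodule.span F (Set.range (graphBasis u x y B)) := by
  intro B B' h
  dsimp only at h
  ext j k
  have hmem : ∑ k, (B j k - B' j k) • y k ∈ Submodule.span F (Set.range u) := by
    rw [← span_graphBasis_inf huP hyP hx B]
    refine ⟨?_, Submodule.sum_mem _ fun k _ => P.smul_mem _ (hyP k)⟩
    have h1 : x j + ∑ k, B j k • y k ∈ Submodule.span F (Set.range (graphBasis u x y B)) :=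
      Submodule.subset_span ⟨Sum.inr j, rfl⟩
    have h2 : x j + ∑ k, B' j k • y k ∈ Submodule.span F (Set.range (graphBasis u x y B)) :=
      h ▸ Submodule.subset_span ⟨Sum.inr j, rfl⟩
    have h3 := Submodule.sub_mem _ h1 h2
    have h4 : x j + ∑ k, B j k • y k - (x j + ∑ k, B' j k • y k) =
        ∑ k, (B j k - B' j k) • y k := by
      simp only [sub_smul, Finset.sum_sub_distrib]
      abel
    exact h4 ▸ h3
  have h0 : ∑ k, (B j k - B' j k) • ((Submodule.span F (Set.range u)).mkQ ∘ y) k = 0 := by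
    have := (Submodule.Quotient.mk_eq_zero _).2 hmem
    rw [← Submodule.mkQ_apply, map_sum] at this
    simpa using this
  exact sub_eq_zero.1 (Fintype.linearIndependent_iff.1 hy _ h0 k)

/-- Expanding `(a j - b j) • y j` as a difference of two graph rows expresses the value of a
multilinear form at `(u, y)` through its values at `2 ^ i` graph bases, whose matrices agree off
the diagonal. -/
theorem MultilinearMap.prod_sub_mul_eq_sum_graphBasis [DecidableEq ι] (A : Matrix ι ι F)
    (a b : ι → F) (ψ : MultilinearMap F (fun _ : κ ⊕ ι => V) F) :
    (∏ j, (a j - b j)) * ψ (Sum.elim u y) =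
      ∑ S : ι → Bool, (∏ j, bif S j then (1 : F) else -1) *
        ψ (graphBasis u x y (A + Matrix.diagonal fun j => bif S j then a j else b j)) := by
  have hrow : ∀ (S : ι → Bool) (j : ι),
      x j + ∑ k, (A + Matrix.diagonal fun j => bif S j then a j else b j) j k • y k =
        x j + ∑ k, A j k • y k + (bif S j then a j else b j) • y j := by
    intro S j
    simp [Matrix.add_apply, add_smul, Finset.sum_add_distrib, Matrix.diagonal_apply, ite_smul,
      add_assoc]
  have hl := (ψ.currySum u).map_smul_univ (fun j => a j - b j) y
  have hdiff : (fun j => (a j - b j) • y j) = fun j => ∑ t : Bool, (bif t then (1 : F) else -1) •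
      (x j + ∑ k, A j k • y k + (bif t then a j else b j) • y j) := by
    funext j
    simp only [Fintype.sum_bool, cond_true, cond_false, sub_smul]
    module
  rw [hdiff, MultilinearMap.map_sum] at hl
  rw [MultilinearMap.currySum_apply', smul_eq_mul] at hl
  rw [← hl]
  refine Finset.sum_congr rfl fun S _ => ?_
  rw [MultilinearMap.map_smul_univ, MultilinearMap.currySum_apply', smul_eq_mul, graphBasis]
  simp only [hrow]

end

/-! ### Linear forms in the minors -/

/-- The linear form `∑ α, f α * X_α` in the maximal minors, as a multilinear form in the rows. -/
noncomputable def minorForm {F : Type*} [Field F] {ℓ m : ℕ} (f : (Fin ℓ ↪o Fin m) → F) :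
    MultilinearMap F (fun _ : Fin ℓ => Fin m → F) F :=
  ∑ α, f α • (Matrix.detRowAlternating (n := Fin ℓ) (R := F)).toMultilinearMap.compLinearMap
    fun _ => LinearMap.funLeft F F α

theorem minorForm_apply {F : Type*} [Field F] {ℓ m : ℕ} (f : (Fin ℓ ↪o Fin m) → F)
    (v : Fin ℓ → Fin m → F) :
    minorForm f v = ∑ α, f α * ((Matrix.of v).submatrix id α).det := by
  simp only [minorForm, _root_.sum_apply, _root_.smul_apply, smul_eq_mul]
  rfl

/-- Another basis of the same space multiplies all maximal minors by the same unit. -/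
theorem exists_minorForm_eq_mul {F : Type*} [Field F] {ℓ m : ℕ}
    {M : GrassmannPoint F ℓ m → Matrix (Fin ℓ) (Fin m) F} (hM : IsRepresentativeChoice M)
    (Q : GrassmannPoint F ℓ m) (v : Fin ℓ → Fin m → F) (hv : LinearIndependent F v)
    (hvQ : ∀ j, v j ∈ Q.1) :
    ∃ c : F, c ≠ 0 ∧ ∀ f, minorForm f v = c * plueckerEval M f Q := by
  have hT : ∀ j, ∃ g : Fin ℓ → F, ∑ k, g k • (M Q).row k = v j := fun j =>
    (Submodule.mem_span_range_iff_exists_fun F).1 ((hM Q).2.symm ▸ hvQ j)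
  choose T hT using hT
  have hmul : Matrix.of v = Matrix.of T * M Q := by
    ext j k
    rw [Matrix.of_apply, ← hT j, Matrix.mul_apply]
    simp [Matrix.row]
  refine ⟨(Matrix.of T).det, ?_, fun f => ?_⟩
  · intro h0
    obtain ⟨w, hw, hw0⟩ := Matrix.exists_vecMul_eq_zero_iff.2 h0
    refine hw (funext (Fintype.linearIndependent_iff.1 hv w ?_))
    have h : Matrix.vecMul w (Matrix.of v) = 0 := by
      rw [hmul, ← Matrix.vecMul_vecMul, hw0, Matrix.zero_vecMul]
    rw [← h, Matrix.vecMul_eq_sum]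
    rfl
  · rw [minorForm_apply]
    change _ = _ * ∑ α, f α * ((M Q).submatrix id α).det
    rw [Finset.mul_sum]
    refine Finset.sum_congr rfl fun α _ => ?_
    have : (Matrix.of v).submatrix id α = Matrix.of T * (M Q).submatrix id α := by
      rw [hmul]
      ext j k
      simp [Matrix.mul_apply]
    rw [this, Matrix.det_mul]
    ring

/-- The points at distance `i` from `P` over a flag `U ≤ P ≤ W`, where `X = W / P`, are parametrized
by the `i × i` matrices, so that changing a diagonal by independent choices `a j` or `b j` gives
points related to `P` by a relation among the coordinates of the code words. -/
theorem exists_graphPoints {F : Type*} [Field F] {ℓ m : ℕ}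
    {M : GrassmannPoint F ℓ m → Matrix (Fin ℓ) (Fin m) F} (hM : IsRepresentativeChoice M)
    (P : GrassmannPoint F ℓ m) (i : ℕ) (U : Submodule F (Fin m → F)) (hUP : U ≤ P.1)
    (hU : Module.finrank F U + i = ℓ) (X : Submodule F ((Fin m → F) ⧸ P.1))
    (hX : Module.finrank F X = i) :
    ∃ Q : Matrix (Fin i) (Fin i) F → GrassmannPoint F ℓ m,
      (∀ B, (Q B).1 ⊓ P.1 = U) ∧ (∀ B, (Q B).1.map P.1.mkQ = X) ∧ Function.Injective Q ∧
      ∀ (A : Matrix (Fin i) (Fin i) F) (a b : Fin i → F), (∀ j, a j ≠ b j) →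
        ∃ μ : (Fin i → Bool) → F, (∀ S, μ S ≠ 0) ∧ ∀ c ∈ grassmannCode M,
          c P = ∑ S, μ S * c (Q (A + Matrix.diagonal fun j => bif S j then a j else b j)) := by
  have hUrank := finrank_map_mkQ_add hUP
  rw [P.2] at hUrank
  obtain ⟨y, hyP, hy, -⟩ := exists_basis_of_map U.mkQ P.1
    (i := i) (by omega)
  have hXc : (X.comap P.1.mkQ).map P.1.mkQ = X :=
    Submodule.map_comap_eq_of_surjective (Submodule.mkQ_surjective _) X
  obtain ⟨x, -, hx, hxX⟩ := exists_basis_of_map P.1.mkQ (X.comap P.1.mkQ) (i := i) (by rw [hXc, hX])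
  rw [hXc] at hxX
  obtain ⟨u, huU', hu, huU⟩ := exists_basis_of_map
    (LinearMap.id : (Fin m → F) →ₗ[F] Fin m → F) U (i := Module.finrank F U)
    (by rw [Submodule.map_id])
  rw [Submodule.map_id] at huU
  change LinearIndependent F u at hu
  change Submodule.span F (Set.range u) = U at huU
  have huP : ∀ k, u k ∈ P.1 := fun k => hUP (huU' k)
  have hli : ∀ B, LinearIndependent F (graphBasis u x y B) :=
    linearIndependent_graphBasis hu huP hx hyP
  have hrank : ∀ B : Matrix (Fin i) (Fin i) F,
      Module.finrank F (Submodule.span F (Set.range (graphBasis u x y B))) = ℓ := by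
    intro B
    rw [finrank_span_eq_card (hli B), Fintype.card_sum, Fintype.card_fin, Fintype.card_fin, hU]
  obtain ⟨Q, hQspan⟩ : ∃ Q : Matrix (Fin i) (Fin i) F → GrassmannPoint F ℓ m,
      ∀ B, (Q B).1 = Submodule.span F (Set.range (graphBasis u x y B)) :=
    ⟨fun B => ⟨_, hrank B⟩, fun _ => rfl⟩
  refine ⟨Q, ?_, ?_, ?_, ?_⟩
  · intro B
    rw [hQspan]
    exact (span_graphBasis_inf huP hyP hx B).trans huU
  · intro B
    rw [hQspan, ← hxX]
    exact map_mkQ_span_graphBasis huP hyP B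
  · intro B B' h
    rw [← huU] at hy
    exact span_graphBasis_injective huP hyP hx hy
      ((hQspan B).symm.trans ((congrArg Subtype.val h).trans (hQspan B')))
  · intro A a b hab
    let σ : Fin (Module.finrank F U) ⊕ Fin i ≃ Fin ℓ := finSumFinEquiv.trans (finCongr hU)
    have hvalue : ∀ (R : GrassmannPoint F ℓ m) (v : Fin (Module.finrank F U) ⊕ Fin i → Fin m → F),
        LinearIndependent F v → (∀ j, v j ∈ R.1) → ∃ c : F, c ≠ 0 ∧
          ∀ f, (minorForm f).domDomCongr σ.symm v = c * plueckerEval M f R := by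
      intro R v hv hvR
      exact exists_minorForm_eq_mul hM R (v ∘ σ.symm) (hv.comp _ σ.symm.injective)
        fun j => hvR _
    have huy : LinearIndependent F (Sum.elim u y) :=
      have huU'' : LinearIndependent F fun k => (⟨u k, huU' k⟩ : U) :=
        LinearIndependent.of_comp U.subtype hu
      huU''.sumElim_of_quotient y hy
    obtain ⟨p, hp, hpf⟩ := hvalue P (Sum.elim u y) huy
      (by rintro (k | j); exacts [huP k, hyP j])
    have hQ : ∀ B, ∃ c : F, c ≠ 0 ∧ ∀ f, (minorForm f).domDomCongr σ.symm (graphBasis u x y B) =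
        c * plueckerEval M f (Q B) := fun B =>
      hvalue (Q B) _ (hli B) fun j => hQspan B ▸ Submodule.subset_span ⟨j, rfl⟩
    choose r hr hrf using hQ
    have hprod : ∏ j, (a j - b j) ≠ 0 := Finset.prod_ne_zero_iff.2 fun j _ => sub_ne_zero.2 (hab j)
    refine ⟨fun S => (∏ j, (a j - b j))⁻¹ * p⁻¹ * ((∏ j, bif S j then (1 : F) else -1) *
      r (A + Matrix.diagonal fun j => bif S j then a j else b j)), fun S => ?_, ?_⟩
    · have hsign : ∏ j, (bif S j then (1 : F) else -1) ≠ 0 := by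
        refine Finset.prod_ne_zero_iff.2 fun j _ => ?_
        cases S j <;> simp
      exact mul_ne_zero (mul_ne_zero (inv_ne_zero hprod) (inv_ne_zero hp))
        (mul_ne_zero hsign (hr _))
    · rintro _ ⟨f, rfl⟩
      have h := MultilinearMap.prod_sub_mul_eq_sum_graphBasis (u := u) (x := x) (y := y) A a b
        ((minorForm f).domDomCongr σ.symm)
      simp only [hpf, hrf] at h
      simp only [mul_assoc, ← Finset.mul_sum]
      rw [← h]
      field_simp

/-! ### Assembling the checks -/

theorem card_ne_pairs (i : ℕ) : Fintype.card {p : Fin i × Fin i // p.1 ≠ p.2} = i ^ 2 - i := by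
  rw [Fintype.card_subtype]
  have : (Finset.univ.filter fun p : Fin i × Fin i => p.1 ≠ p.2) = Finset.univ.offDiag := by
    ext p; simp
  rw [this, Finset.offDiag_card, Finset.card_univ, Fintype.card_fin, sq]

/-- The square matrix with zero diagonal and prescribed entries off the diagonal. -/
def zeroDiagMatrix {F : Type*} [Zero F] {i : ℕ} (A : {p : Fin i × Fin i // p.1 ≠ p.2} → F) :
    Matrix (Fin i) (Fin i) F :=
  Matrix.of fun j k => if h : j ≠ k then A ⟨(j, k), h⟩ else 0

theorem zeroDiagMatrix_add_diagonal_inj {F : Type*} [AddZeroClass F] {i : ℕ}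
    {A A' : {p : Fin i × Fin i // p.1 ≠ p.2} → F} {d d' : Fin i → F}
    (h : zeroDiagMatrix A + Matrix.diagonal d = zeroDiagMatrix A' + Matrix.diagonal d') :
    A = A' ∧ d = d' := by
  constructor
  · funext ⟨⟨j, k⟩, hjk⟩
    have := congrFun (congrFun h j) k
    simpa [zeroDiagMatrix, Matrix.diagonal_apply_ne _ hjk, show j ≠ k from hjk] using this
  · funext j
    have := congrFun (congrFun h j) j
    simpa [zeroDiagMatrix] using this

/-- A field with `q` elements contains `⌊q / 2⌋` disjoint pairs. -/
theorem exists_injective_pairs (F : Type*) [Fintype F] :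
    ∃ g : Fin (Fintype.card F / 2) × Bool → F, Function.Injective g := by
  have : Fintype.card (Fin (Fintype.card F / 2) × Bool) ≤ Fintype.card F := by
    simp only [Fintype.card_prod, Fintype.card_fin, Fintype.card_bool]
    omega
  obtain ⟨g⟩ := Function.Embedding.nonempty_of_card_le this
  exact ⟨g, g.injective⟩

/-- The indices of the checks that live over flags `U ≤ P ≤ W` with `dim (P / U) = dim (W / P) = i`:
the pair `(U, W / P)`, a matrix with zero diagonal, and `i` of the disjoint pairs of scalars. -/
abbrev CheckIndex {F : Type*} [Field F] [Fintype F] {ℓ m : ℕ} (P : GrassmannPoint F ℓ m)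
    (i : ℕ) : Type _ :=
  {U : Submodule F P.1 // Module.finrank F U + i = Module.finrank F P.1} ×
    {X : Submodule F ((Fin m → F) ⧸ P.1) // Module.finrank F X = i} ×
    ({p : Fin i × Fin i // p.1 ≠ p.2} → F) × (Fin i → Fin (Fintype.card F / 2))

theorem natCard_checkIndex {F : Type*} [Field F] [Fintype F] {ℓ m : ℕ} (P : GrassmannPoint F ℓ m)
    (i : ℕ) :
    Nat.card (CheckIndex P i) = (Fintype.card F / 2) ^ i * Fintype.card F ^ (i ^ 2 - i) *
      gaussBinom (Fintype.card F) ℓ i * gaussBinom (Fintype.card F) (m - ℓ) i := by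
  classical
  have hquot : Module.finrank F ((Fin m → F) ⧸ P.1) = m - ℓ := by
    have := Submodule.finrank_quotient_add_finrank P.1
    rw [P.2, Module.finrank_fin_fun] at this
    omega
  rw [Nat.card_prod, Nat.card_prod, Nat.card_prod, natCard_submodule_finrank_add_eq,
    natCard_submodule_finrank_eq, hquot, P.2, Nat.card_eq_fintype_card, Nat.card_eq_fintype_card,
    Fintype.card_fun, Fintype.card_fun, card_ne_pairs, Fintype.card_fin, Fintype.card_fin]
  ring

/-- All checks together: flags of different type `i`, different flags, different matrices off the
diagonal and different pairs of scalars all lead to disjoint sets of points `Q`, because `Q`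
determines `U = Q ⊓ P`, the image of `Q` modulo `P`, and the matrix. -/
theorem exists_orthogonalParityChecks_grassmannCode {F : Type*} [Field F] [Fintype F] {ℓ m : ℕ}
    {M : GrassmannPoint F ℓ m → Matrix (Fin ℓ) (Fin m) F} (hM : IsRepresentativeChoice M)
    (P : GrassmannPoint F ℓ m) :
    ∃ 𝒥 : Finset (GrassmannPoint F ℓ m → F),
      OrthogonalParityChecks (grassmannCode M) 𝒥 P ∧
        𝒥.card = numChecks (Fintype.card F) ℓ m := by
  classical
  obtain ⟨g, hg⟩ := exists_injective_pairs F
  have hgraph := fun (i : ℕ)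
      (U : {U : Submodule F P.1 // Module.finrank F U + i = Module.finrank F P.1})
      (X : {X : Submodule F ((Fin m → F) ⧸ P.1) // Module.finrank F X = i}) =>
    exists_graphPoints hM P i (U.1.map P.1.subtype) (Submodule.map_subtype_le _ _)
      (by rw [Submodule.finrank_map_subtype_eq, U.2, P.2]) X.1 X.2
  choose Q hQU hQX hQinj hrel using hgraph
  let K := Σ i : Finset.Icc 1 ℓ, CheckIndex P i.1
  let D : (k : K) → (Fin k.1.1 → Bool) → Fin k.1.1 → F := fun k S j =>
    bif S j then g (k.2.2.2.2 j, true) else g (k.2.2.2.2 j, false)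
  have hD : ∀ k S, D k S = fun j => g (k.2.2.2.2 j, S j) := by
    intro k S
    funext j
    cases h : S j <;> simp [D, h]
  let R : (k : K) → (Fin k.1.1 → Bool) → GrassmannPoint F ℓ m := fun k S =>
    Q k.1.1 k.2.1 k.2.2.1 (zeroDiagMatrix k.2.2.2.1 + Matrix.diagonal (D k S))
  have hRinj : ∀ k k' S S', R k S = R k' S' → k = k' := by
    rintro ⟨⟨i, hi⟩, U, X, A, p⟩ ⟨⟨i', hi'⟩, U', X', A', p'⟩ S S' h
    have hX : X.1 = X'.1 := by
      rw [← hQX i U X, ← hQX i' U' X']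
      exact congrArg (fun Z : GrassmannPoint F ℓ m => Z.1.map P.1.mkQ) h
    have hii : i = i' := X.2.symm.trans ((congrArg
      (fun Z : Submodule F ((Fin m → F) ⧸ P.1) => Module.finrank F Z) hX).trans X'.2)
    subst hii
    obtain rfl : X = X' := Subtype.ext hX
    have hU : U.1.map P.1.subtype = U'.1.map P.1.subtype := by
      rw [← hQU i U X, ← hQU i U' X]
      exact congrArg (fun Z : GrassmannPoint F ℓ m => Z.1 ⊓ P.1) h
    obtain rfl : U = U' := Subtype.ext
      (Submodule.map_injective_of_injective P.1.injective_subtype hU)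
    obtain ⟨rfl, hd⟩ := zeroDiagMatrix_add_diagonal_inj (hQinj i U X h)
    have hp : p = p' := by
      funext j
      rw [hD, hD] at hd
      exact congrArg Prod.fst (hg (congrFun hd j))
    rw [hp]
  have hRinj' : ∀ k, Function.Injective (R k) := by
    intro k S S' h
    have hd := (zeroDiagMatrix_add_diagonal_inj (hQinj _ _ _ h)).2
    rw [hD, hD] at hd
    funext j
    exact congrArg Prod.snd (hg (congrFun hd j))
  have hRP : ∀ k S, R k S ≠ P := by
    rintro ⟨⟨i, hi⟩, U, X, A, p⟩ S h
    have h1 := hQX i U X (zeroDiagMatrix A + Matrix.diagonal (D ⟨⟨i, hi⟩, U, X, A, p⟩ S))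
    change (R ⟨⟨i, hi⟩, U, X, A, p⟩ S).1.map P.1.mkQ = X.1 at h1
    rw [h, Submodule.mkQ_map_self] at h1
    have h2 : Module.finrank F X.1 = i := X.2
    rw [← h1, finrank_bot] at h2
    have := (Finset.mem_Icc.1 hi).1
    omega
  have hword : ∀ k, ∃ ω ∈ dualCode (grassmannCode M), ω P = 1 ∧ (∃ Z, Z ≠ P ∧ ω Z ≠ 0) ∧
      ∀ Z, Z ≠ P → ω Z ≠ 0 → ∃ S, Z = R k S := by
    intro k
    obtain ⟨μ, hμ, h⟩ := hrel k.1.1 k.2.1 k.2.2.1 (zeroDiagMatrix k.2.2.2.1)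
      (fun j => g (k.2.2.2.2 j, true)) (fun j => g (k.2.2.2.2 j, false))
      (fun j hj => by simpa using hg hj)
    exact exists_mem_dualCode_of_relation _ P (R k) (hRinj' k) (hRP k) μ hμ h
  choose ω hωd hωP hωne hωsupp using hword
  have : ∀ i : Finset.Icc 1 ℓ, Fintype (CheckIndex P i.1) := fun i => Fintype.ofFinite _
  obtain ⟨𝒥, h𝒥, hcard⟩ := exists_orthogonalParityChecks_of_family (grassmannCode M) P ω hωd hωP
    hωne
    (by
      intro k k' Z hZ h h'
      obtain ⟨S, hS⟩ := hωsupp k Z hZ h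
      obtain ⟨S', hS'⟩ := hωsupp k' Z hZ h'
      exact hRinj k k' S S' (hS.symm.trans hS'))
  refine ⟨𝒥, h𝒥, ?_⟩
  rw [hcard, Fintype.card_sigma, numChecks]
  simp only [← natCard_checkIndex P]
  exact (Finset.sum_congr rfl fun i _ => Nat.card_eq_fintype_card.symm).trans
    (Finset.sum_coe_sort (Finset.Icc 1 ℓ) fun i => Nat.card (CheckIndex P i))

theorem corollary4p4 {F : Type*} [Field F] [Fintype F] [DecidableEq F] (ℓ m : ℕ)
    (hℓ : 1 ≤ ℓ) (hm : ℓ ≤ m)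
    (M : GrassmannPoint F ℓ m → Matrix (Fin ℓ) (Fin m) F) (hM : IsRepresentativeChoice M) :
    (∀ P : GrassmannPoint F ℓ m, ∃ 𝒥 : Finset (GrassmannPoint F ℓ m → F),
      OrthogonalParityChecks (grassmannCode M) 𝒥 P ∧
        𝒥.card = numChecks (Fintype.card F) ℓ m) ∧
    (∀ 𝒥 : GrassmannPoint F ℓ m → Finset (GrassmannPoint F ℓ m → F),
      (∀ P, OrthogonalParityChecks (grassmannCode M) (𝒥 P) P ∧
        (𝒥 P).card = numChecks (Fintype.card F) ℓ m) →
      ∀ c ∈ grassmannCode M, ∀ e : GrassmannPoint F ℓ m → F,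
        hammingNorm e ≤ numChecks (Fintype.card F) ℓ m / 2 →
        majorityDecode 𝒥 (c + e) = c) := by
  refine ⟨exists_orthogonalParityChecks_grassmannCode hM, fun 𝒥 h𝒥 c hc e he => funext fun P => ?_⟩
  exact (h𝒥 P).1.majorityVote_add hc e (by rw [(h𝒥 P).2]; omega)
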